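/- A metric space is called *proper* if it is unbounded and all its closed balls are compact. A group is *locally finite* if each of its finitely generated subgroups is finite. A map $f:X\to Y$ between metric spaces is *macro-uniform* if for every $\delta<\infty$ there is $\varepsilon<\infty$ such that $\mathrm{dist}(f(x),f(x'))\le\varepsilon$ for all $x,x'\in X$ with $\mathrm{dist}(x,x')\le\delta$. Metric spaces $X,Y$ are *coarsely equivalent* if there are macro-uniform maps $f:X\to Y$ and $g:Y\to X$ such that $\sup_{y\in Y}\mathrm{dist}(f(g(y)),y)<\infty$ and $\sup_{x\in X}\mathrm{dist}(g(f(x)),x)<\infty$. Let $G$ and $H$ be countable locally finite groups, each endowed with a proper left-invariant metric (so, in particular, both groups are infinite). Then the metric spaces $G$ and $H$ are coarsely equivalent. -/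

import Mathlib

open scoped NNReal ENNReal

namespace Coarse

/-- The oscillation `ω_f(δ) = sup {dist (f x) (f x') : dist x x' ≤ δ}` of a map between metric
spaces, with values in `[0, ∞]`. -/
noncomputable def osc {X Y : Type*} [MetricSpace X] [MetricSpace Y]
    (f : X → Y) (δ : ℝ≥0) : ℝ≥0∞ :=
  ⨆ (x : X) (x' : X) (_ : dist x x' ≤ δ), edist (f x) (f x')

/-- A map is macro-uniform if for every `δ < ∞` there is `ε < ∞` with `ω_f(δ) ≤ ε`. -/
def MacroUniform {X Y : Type*} [MetricSpace X] [MetricSpace Y] (f : X → Y) : Prop :=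
  ∀ δ : ℝ≥0, ∃ ε : ℝ≥0, osc f δ ≤ ε

/-- The sup-distance, with values in `[0, ∞]`, between two maps into a metric space. -/
noncomputable def mapDist {X Y : Type*} [MetricSpace Y] (f g : X → Y) : ℝ≥0∞ :=
  ⨆ x : X, edist (f x) (g x)

/-- A coarse equivalence: a macro-uniform map with a macro-uniform inverse up to finite
distance. -/
def IsCoarseEquivalence {X Y : Type*} [MetricSpace X] [MetricSpace Y] (f : X → Y) : Prop :=
  MacroUniform f ∧ ∃ g : Y → X, MacroUniform g ∧
    mapDist (f ∘ g) id < ∞ ∧ mapDist (g ∘ f) id < ∞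

/-- Two metric spaces are coarsely equivalent if there is a coarse equivalence between them. -/
def CoarselyEquivalent (X Y : Type*) [MetricSpace X] [MetricSpace Y] : Prop :=
  ∃ f : X → Y, IsCoarseEquivalence f

/-- Proper metric spaces in the sense used here: unbounded, with all closed balls compact. -/
structure IsProper (X : Type*) [MetricSpace X] : Prop where
  unbounded : ¬ Bornology.IsBounded (Set.univ : Set X)
  isCompact_closedBall : ∀ (x : X) (r : ℝ), 0 ≤ r → IsCompact (Metric.closedBall x r)

/-- The metric of `G` is left-invariant. -/
def IsLeftInvariant (G : Type*) [Group G] [MetricSpace G] : Prop :=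
  ∀ g x y : G, dist (g * x) (g * y) = dist x y

/-- A group is locally finite if each finitely generated subgroup is finite. -/
def IsLocallyFiniteGroup (G : Type*) [Group G] : Prop :=
  ∀ K : Subgroup G, K.FG → Finite K

end Coarse

/-! By a Baire argument all balls are finite, so by local finiteness each group is exhausted by
finite subgroups `U k`, `V k` eventually containing every ball. Coarse closeness then means lying in
a common left coset at some level. It suffices to find a relation, total on both sides, under which
`U k`-close pairs become `V k`-close and `V k`-close pairs become `U (k + 1)`-close; any selections
`f`, `g` from it are the required maps.

Orders need not divide one another, so exact counting is replaced by slack: one `V k`-coset absorbs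
any `a` or `a + 1` cosets of `U k`. If the next index is large, this flexibility propagates with the
roles exchanged (`Matchable.swap`). Two exchanges advance the level by one, and an ultralimit glues
the finite matchings. -/

namespace Coarse

open Filter

/-! ### Combinatorics of matching classes with slack one. -/

section Matching

/-- Every finite set of admissible size can be distributed over the points of a finite set `T`
so that each point receives `a` or `a + 1` elements. -/
theorem exists_map_card_fiber {κ τ : Type*} [DecidableEq τ] [DecidableEq κ] (a : ℕ)
    (T : Finset τ) (K : Finset κ) (h₁ : T.card * a ≤ K.card) (h₂ : K.card ≤ T.card * (a + 1)) :
    ∃ S : τ → Finset κ, (∀ t ∈ T, (S t).card = a ∨ (S t).card = a + 1) ∧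
      (∀ t ∈ T, S t ⊆ K) ∧ (∀ k ∈ K, ∃ t ∈ T, k ∈ S t) ∧
      ∀ t ∈ T, ∀ t' ∈ T, ∀ k, k ∈ S t → k ∈ S t' → t = t' := by
  induction T using Finset.induction_on generalizing K with
  | empty =>
    have : K = ∅ := by simpa using h₂
    exact ⟨fun _ => ∅, by simp [this]⟩
  | insert t₀ T ht ih =>
    rw [Finset.card_insert_of_notMem ht] at h₁ h₂
    obtain ⟨n, hn, hnK, hl, hu⟩ : ∃ n, (n = a ∨ n = a + 1) ∧ n ≤ K.card ∧
        T.card * a ≤ K.card - n ∧ K.card - n ≤ T.card * (a + 1) := by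
      simp only [add_mul, mul_add, one_mul, mul_one] at h₁ h₂ ⊢
      by_cases h : K.card ≤ T.card * a + T.card + a
      · exact ⟨a, Or.inl rfl, by omega, by omega, by omega⟩
      · exact ⟨a + 1, Or.inr rfl, by omega, by omega, by omega⟩
    obtain ⟨K₀, hK₀, hcard⟩ := Finset.exists_subset_card_eq hnK
    have hsd : (K \ K₀).card = K.card - n := by rw [Finset.card_sdiff_of_subset hK₀, hcard]
    obtain ⟨S, hS₁, hS₂, hS₃, hS₄⟩ := ih (K \ K₀) (by omega) (by omega)
    have hne : ∀ t ∈ T, t ≠ t₀ := fun t h e => ht (e ▸ h)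
    have hdisj : ∀ t ∈ T, ∀ k ∈ S t, k ∉ K₀ := fun t h k hk =>
      (Finset.mem_sdiff.1 (hS₂ t h hk)).2
    refine ⟨Function.update S t₀ K₀, ?_, ?_, ?_, ?_⟩
    · intro t h
      rcases Finset.mem_insert.1 h with rfl | h
      · simpa [hcard] using hn
      · simpa [hne t h] using hS₁ t h
    · intro t h
      rcases Finset.mem_insert.1 h with rfl | h
      · simpa using hK₀
      · simpa [hne t h] using (hS₂ t h).trans Finset.sdiff_subset
    · intro k hk
      by_cases hk₀ : k ∈ K₀
      · exact ⟨t₀, by simp, by simpa using hk₀⟩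
      · obtain ⟨t, h, hkt⟩ := hS₃ k (Finset.mem_sdiff.2 ⟨hk, hk₀⟩)
        exact ⟨t, Finset.mem_insert_of_mem h, by simpa [hne t h] using hkt⟩
    · intro t hm t' hm' k hk hk'
      rcases Finset.mem_insert.1 hm with e | h <;> rcases Finset.mem_insert.1 hm' with e' | h'
      · rw [e, e']
      · subst e
        rw [Function.update_self] at hk
        rw [Function.update_of_ne (hne t' h')] at hk'
        exact absurd hk (hdisj t' h' k hk')
      · subst e'
        rw [Function.update_self] at hk'
        rw [Function.update_of_ne (hne t h)] at hk
        exact absurd hk' (hdisj t h k hk)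
      · rw [Function.update_of_ne (hne t h)] at hk
        rw [Function.update_of_ne (hne t' h')] at hk'
        exact hS₄ t h t' h' k hk hk'

/-- Every class of `t` can be matched with every collection of `a` or `a + 1` classes of `s`, by a
relation which is total on both sides and all of whose pairs satisfy `Φ`. -/
def Matchable {α β : Type*} (a : ℕ) (s : Setoid α) (t : Setoid β)
    (Φ : α × β → α × β → Prop) : Prop :=
  ∀ (c : Quotient t) (S : Finset (Quotient s)), (S.card = a ∨ S.card = a + 1) →
    ∃ R : α → β → Prop, (∀ x y, R x y → Quotient.mk s x ∈ S ∧ Quotient.mk t y = c) ∧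
      (∀ x, Quotient.mk s x ∈ S → ∃ y, R x y) ∧ (∀ y, Quotient.mk t y = c → ∃ x, R x y) ∧
      ∀ x y x' y', R x y → R x' y' → Φ (x, y) (x', y')

theorem Matchable.mono {α β : Type*} {a : ℕ} {s : Setoid α} {t : Setoid β}
    {Φ Ψ : α × β → α × β → Prop} (h : Matchable a s t Φ) (hΦ : ∀ p q, Φ p q → Ψ p q) :
    Matchable a s t Ψ := by
  intro c S hS
  obtain ⟨R, h₁, h₂, h₃, h₄⟩ := h c S hS
  exact ⟨R, h₁, h₂, h₃, fun x y x' y' hp hq => hΦ _ _ (h₄ x y x' y' hp hq)⟩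

/-- Passing to a coarser relation `s'` whose classes consist of `d` classes of `s`, and exchanging
the two sides. -/
theorem Matchable.swap {α β : Type*} {a b d : ℕ} {s s' : Setoid α} {t : Setoid β}
    {Φ : α × β → α × β → Prop} (h : Matchable a s t Φ)
    (hΦ : ∀ p q, ¬ s p.1 q.1 → ¬ t p.2 q.2 → Φ p q)
    (hd : ∀ c : Quotient s', ∃ K : Finset (Quotient s), K.card = d ∧
      ∀ x, Quotient.mk s x ∈ K ↔ Quotient.mk s' x = c)
    (h₁ : (b + 1) * a ≤ d) (h₂ : d ≤ b * (a + 1)) :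
    Matchable b t s' (fun p q => Φ p.swap q.swap ∧ (t p.1 q.1 → s' p.2 q.2)) := by
  classical
  intro c T hT
  obtain ⟨K, hK, hKc⟩ := hd c
  obtain ⟨S, hS₁, hS₂, hS₃, hS₄⟩ := exists_map_card_fiber a T K
    (by rcases hT with e | e <;> rw [e, hK] <;> nlinarith)
    (by rcases hT with e | e <;> rw [e, hK] <;> nlinarith)
  choose! R hR₁ hR₂ hR₃ hR₄ using fun τ hτ => h τ (S τ) (hS₁ τ hτ)
  have hclass : ∀ {τ x y}, τ ∈ T → R τ x y → Quotient.mk s' x = c := fun hτ hxy =>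
    (hKc _).1 (hS₂ _ hτ (hR₁ _ hτ _ _ hxy).1)
  refine ⟨fun y x => ∃ τ ∈ T, R τ x y, ?_, ?_, ?_, ?_⟩
  · rintro y x ⟨τ, hτ, hxy⟩
    exact ⟨(hR₁ τ hτ x y hxy).2 ▸ hτ, hclass hτ hxy⟩
  · intro y hy
    obtain ⟨x, hx⟩ := hR₃ _ hy y rfl
    exact ⟨x, _, hy, hx⟩
  · intro x hx
    obtain ⟨τ, hτ, hxτ⟩ := hS₃ _ ((hKc x).2 hx)
    obtain ⟨y, hy⟩ := hR₂ τ hτ x hxτ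
    exact ⟨y, τ, hτ, hy⟩
  · rintro y x y' x' ⟨τ, hτ, hxy⟩ ⟨τ', hτ', hxy'⟩
    refine ⟨?_, fun _ => Quotient.exact ((hclass hτ hxy).trans (hclass hτ' hxy').symm)⟩
    -- Pairs from different pieces are inequivalent on both sides, where `hΦ` gives `Φ` for free.
    by_cases e : τ = τ'
    · subst e
      exact hR₄ τ hτ x y x' y' hxy hxy'
    · obtain ⟨hx, hy⟩ := hR₁ τ hτ x y hxy
      obtain ⟨hx', hy'⟩ := hR₁ τ' hτ' x' y' hxy'
      refine hΦ _ _ (fun hs => e ?_) (fun ht => e ?_)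
      · have : Quotient.mk s x = Quotient.mk s x' := Quotient.sound hs
        exact hS₄ τ hτ τ' hτ' _ hx (this ▸ hx')
      · rw [← hy, ← hy']
        exact Quotient.sound ht

/-- The intervals from `a * b + a` to `a * b + b` move by `a` and lengthen with `b`, so eventually
they overlap and cover every large `d`. -/
theorem exists_forall_ge_between_mul {a : ℕ} (ha : 1 ≤ a) :
    ∃ N : ℕ, ∀ d ≥ N, ∃ b, 1 ≤ b ∧ (b + 1) * a ≤ d ∧ d ≤ b * (a + 1) := by
  refine ⟨a * (2 * a + 1), fun d hd => ⟨d / a - 1, ?_⟩⟩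
  have h1 : 2 * a + 1 ≤ d / a := by
    rw [Nat.le_div_iff_mul_le ha]; linarith
  have h2 := Nat.div_add_mod d a
  have h3 := Nat.mod_lt d ha
  obtain ⟨q, hq⟩ : ∃ q, d / a = q + 1 := ⟨d / a - 1, by omega⟩
  rw [hq] at h1 h2 ⊢
  refine ⟨by omega, ?_, ?_⟩ <;> simp only [Nat.add_sub_cancel] <;> nlinarith [Nat.zero_le (d % a)]

end Matching

/-! ### Chains of finite subgroups and the limit matching. -/

section Chains

variable {G : Type*} [Group G]

theorem exists_finset_card_eq_relIndex {U U' : Subgroup G} (h : U ≤ U') [Finite U']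
    (c : Quotient (QuotientGroup.leftRel U')) :
    ∃ K : Finset (Quotient (QuotientGroup.leftRel U)), K.card = U.relIndex U' ∧
      ∀ x, Quotient.mk _ x ∈ K ↔ Quotient.mk (QuotientGroup.leftRel U') x = c := by
  classical
  let e := Subgroup.quotientEquivProdOfLE h
  have := Fintype.ofFinite (U' ⧸ U.subgroupOf U')
  have hinj : Function.Injective fun q => e.symm (c, q) := fun q q' hq =>
    (Prod.mk.inj (e.symm.injective hq)).2
  refine ⟨Finset.univ.image fun q => e.symm (c, q), ?_, fun x => ?_⟩
  · rw [Finset.card_image_of_injective _ hinj, Finset.card_univ, Subgroup.relIndex,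
      Subgroup.index, Nat.card_eq_fintype_card]
  · have hx : (e (Quotient.mk _ x)).1 = Quotient.mk (QuotientGroup.leftRel U') x := rfl
    rw [← hx, Finset.mem_image]
    constructor
    · rintro ⟨q, -, hq⟩
      exact (congrArg (fun z => (e z).1) hq).symm.trans
        (congrArg Prod.fst (e.apply_symm_apply (c, q)))
    · intro hc
      subst hc
      exact ⟨(e (Quotient.mk _ x)).2, Finset.mem_univ _, e.symm_apply_apply (Quotient.mk _ x)⟩

theorem IsLocallyFiniteGroup.exists_finite_subgroup [Infinite G] (hG : IsLocallyFiniteGroup G)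
    (U : Subgroup G) [Finite U] {F : Set G} (hF : F.Finite) (N : ℕ) :
    ∃ U' : Subgroup G, Finite U' ∧ U ≤ U' ∧ F ⊆ U' ∧ N ≤ U.relIndex U' := by
  obtain ⟨A, hA⟩ := Infinite.exists_subset_card_eq G (N * Nat.card U)
  have hfin : ((U : Set G) ∪ F ∪ A).Finite :=
    ((Set.toFinite _).union hF).union A.finite_toSet
  -- Adjoining `N * Nat.card U` elements forces index at least `N`.
  let U' := Subgroup.closure ((U : Set G) ∪ F ∪ A)
  have hU' : Finite U' := hG U' ⟨hfin.toFinset, by simp [U']⟩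
  have hsub : (U : Set G) ∪ F ∪ A ⊆ U' := Subgroup.subset_closure
  have hle : U ≤ U' := fun x hx => hsub (Or.inl (Or.inl hx))
  refine ⟨U', hU', hle, fun x hx => hsub (Or.inl (Or.inr hx)), ?_⟩
  have h1 : N * Nat.card U ≤ Nat.card U' := by
    rw [← hA, ← Set.ncard_coe_finset A]
    exact Set.ncard_le_ncard (fun x hx => hsub (Or.inr hx)) (Set.toFinite (U' : Set G))
  have h2 : Nat.card U * U.relIndex U' = Nat.card U' := by
    have := Subgroup.relIndex_mul_relIndex ⊥ U U' bot_le hle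
    simpa [Subgroup.relIndex_bot_left] using this
  have h3 : 0 < Nat.card U := Nat.card_pos
  rw [← h2] at h1
  exact Nat.le_of_mul_le_mul_left (by linarith) h3

variable {H : Type*} [Group H]

/-- Up to level `k`: pairs which are `U i`-close on the left are `V i`-close on the right, and pairs
which are `V i`-close on the right are `U (i + 1)`-close on the left. -/
def Interleaved (U : ℕ → Subgroup G) (V : ℕ → Subgroup H) (k : ℕ) (p q : G × H) : Prop :=
  (∀ i ≤ k, p.1⁻¹ * q.1 ∈ U i → p.2⁻¹ * q.2 ∈ V i) ∧
    ∀ i < k, p.2⁻¹ * q.2 ∈ V i → p.1⁻¹ * q.1 ∈ U (i + 1)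

theorem exists_chains [Infinite G] [Infinite H] (hG : IsLocallyFiniteGroup G)
    (hH : IsLocallyFiniteGroup H) {F : ℕ → Set G} {E : ℕ → Set H}
    (hF : ∀ k, (F k).Finite) (hE : ∀ k, (E k).Finite) :
    ∃ (U : ℕ → Subgroup G) (V : ℕ → Subgroup H) (a : ℕ → ℕ),
      (∀ k, Finite (U k)) ∧ (∀ k, Finite (V k)) ∧ Monotone U ∧ Monotone V ∧
      (∀ k, F k ⊆ U (k + 1)) ∧ (∀ k, E k ⊆ V (k + 1)) ∧ (∀ k, 1 ≤ a k) ∧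
      ∀ k, ∃ b, (b + 1) * a k ≤ (U k).relIndex (U (k + 1)) ∧
        (U k).relIndex (U (k + 1)) ≤ b * (a k + 1) ∧
        (a (k + 1) + 1) * b ≤ (V k).relIndex (V (k + 1)) ∧
        (V k).relIndex (V (k + 1)) ≤ a (k + 1) * (b + 1) := by
  let Stage := {p : Subgroup G × Subgroup H × ℕ // Finite p.1 ∧ Finite p.2.1 ∧ 1 ≤ p.2.2}
  have step : ∀ (k : ℕ) (p : Stage), ∃ p' : Stage, p.1.1 ≤ p'.1.1 ∧ p.1.2.1 ≤ p'.1.2.1 ∧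
      F k ⊆ p'.1.1 ∧ E k ⊆ p'.1.2.1 ∧ ∃ b, (b + 1) * p.1.2.2 ≤ p.1.1.relIndex p'.1.1 ∧
        p.1.1.relIndex p'.1.1 ≤ b * (p.1.2.2 + 1) ∧
        (p'.1.2.2 + 1) * b ≤ p.1.2.1.relIndex p'.1.2.1 ∧
        p.1.2.1.relIndex p'.1.2.1 ≤ p'.1.2.2 * (b + 1) := by
    rintro k ⟨⟨U, V, a⟩, hU, hV, ha⟩
    dsimp only at hU hV ha
    obtain ⟨N, hN⟩ := exists_forall_ge_between_mul ha
    obtain ⟨U', hU', hle, hFU, hind⟩ := hG.exists_finite_subgroup U (hF k) N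
    obtain ⟨b, hb, h₁, h₂⟩ := hN _ hind
    obtain ⟨M, hM⟩ := exists_forall_ge_between_mul hb
    obtain ⟨V', hV', hle', hEV, hind'⟩ := hH.exists_finite_subgroup V (hE k) M
    obtain ⟨a', ha', h₃, h₄⟩ := hM _ hind'
    exact ⟨⟨⟨U', V', a'⟩, hU', hV', ha'⟩, hle, hle', hFU, hEV, b, h₁, h₂, h₃, h₄⟩
  choose next hnext using step
  let p : ℕ → Stage := fun n =>
    Nat.rec (⟨(⊥, ⊥, 1), inferInstance, inferInstance, le_rfl⟩ : Stage) next n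
  exact ⟨fun k => (p k).1.1, fun k => (p k).1.2.1, fun k => (p k).1.2.2, fun k => (p k).2.1,
    fun k => (p k).2.2.1, monotone_nat_of_le_succ fun k => (hnext k (p k)).1,
    monotone_nat_of_le_succ fun k => (hnext k (p k)).2.1, fun k => (hnext k (p k)).2.2.1,
    fun k => (hnext k (p k)).2.2.2.1, fun k => (p k).2.2.2, fun k => (hnext k (p k)).2.2.2.2⟩

theorem matchable_interleaved {U : ℕ → Subgroup G} {V : ℕ → Subgroup H} {a : ℕ → ℕ}
    (hU : ∀ k, Finite (U k)) (hV : ∀ k, Finite (V k)) (hUm : Monotone U) (hVm : Monotone V)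
    (ha : ∀ k, 1 ≤ a k)
    (hUV : ∀ k, ∃ b, (b + 1) * a k ≤ (U k).relIndex (U (k + 1)) ∧
        (U k).relIndex (U (k + 1)) ≤ b * (a k + 1) ∧
        (a (k + 1) + 1) * b ≤ (V k).relIndex (V (k + 1)) ∧
        (V k).relIndex (V (k + 1)) ≤ a (k + 1) * (b + 1)) (k : ℕ) :
    Matchable (a k) (QuotientGroup.leftRel (U k)) (QuotientGroup.leftRel (V k))
      (Interleaved U V k) := by
  induction k with
  | zero =>
    intro c S hS
    -- At level zero the full product works: all right-hand points share one `V 0`-coset.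
    refine ⟨fun x y => Quotient.mk _ x ∈ S ∧ Quotient.mk _ y = c, fun x y h => h, ?_, ?_, ?_⟩
    · intro x hx
      obtain ⟨y, rfl⟩ := Quotient.exists_rep c
      exact ⟨y, hx, rfl⟩
    · intro y hy
      have h0 := ha 0
      obtain ⟨q, hq⟩ : S.Nonempty := Finset.card_pos.1 (by omega)
      obtain ⟨x, rfl⟩ := Quotient.exists_rep q
      exact ⟨x, hq, hy⟩
    · rintro x y x' y' ⟨-, hy⟩ ⟨-, hy'⟩
      refine ⟨fun i hi _ => ?_, fun i hi => absurd hi (Nat.not_lt_zero i)⟩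
      obtain rfl : i = 0 := by omega
      exact QuotientGroup.leftRel_apply.1 (Quotient.exact (hy.trans hy'.symm))
  | succ k ih =>
    obtain ⟨b, h₁, h₂, h₃, h₄⟩ := hUV k
    have hU' := hU (k + 1)
    have hV' := hV (k + 1)
    -- This exchange adds the clause from `V k` to `U (k + 1)`; the next adds the one from `U (k +
    -- 1)` to `V (k + 1)`. Pairs in distinct cosets at the current levels satisfy the earlier
    -- clauses vacuously.
    have hmid := ih.swap (s' := QuotientGroup.leftRel (U (k + 1)))
      (fun p q hs ht => by
        rw [QuotientGroup.leftRel_apply] at hs ht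
        exact ⟨fun i hi h => absurd (hUm hi h) hs, fun i hi h => absurd (hVm hi.le h) ht⟩)
      (exists_finset_card_eq_relIndex (hUm k.le_succ)) h₁ h₂
    refine (hmid.swap (s' := QuotientGroup.leftRel (V (k + 1)))
      (fun p q ht hs => ?_)
      (exists_finset_card_eq_relIndex (hVm k.le_succ)) h₃ h₄).mono ?_
    · rw [QuotientGroup.leftRel_apply] at hs ht
      refine ⟨⟨fun i hi h => absurd (hUm (by omega) h) hs,
        fun i hi h => absurd (hVm hi.le h) ht⟩, fun h => ?_⟩
      rw [QuotientGroup.leftRel_apply] at h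
      exact absurd h ht
    · rintro p q ⟨⟨⟨hl, hr⟩, hVU⟩, hUV'⟩
      simp only [QuotientGroup.leftRel_apply, Prod.swap_swap, Prod.fst_swap, Prod.snd_swap]
        at hl hr hVU hUV'
      refine ⟨fun i hi => ?_, fun i hi => ?_⟩
      · rcases Nat.le_succ_iff.1 hi with hi | rfl
        exacts [hl i hi, hUV']
      · rcases Nat.lt_succ_iff_lt_or_eq.1 hi with hi | rfl
        exacts [hr i hi, hVU]

/-- A relation matching the two groups at all levels simultaneously, obtained as an ultralimit of
the matchings between the finite stages. -/
theorem exists_interleaved_relation [Infinite G] {U : ℕ → Subgroup G} {V : ℕ → Subgroup H}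
    {a : ℕ → ℕ} (hU : ∀ k, Finite (U k)) (hV : ∀ k, Finite (V k)) (hUm : Monotone U)
    (hVm : Monotone V) (hUtop : ∀ x, ∃ k, x ∈ U k) (hVtop : ∀ y, ∃ k, y ∈ V k)
    (ha : ∀ k, 1 ≤ a k)
    (hM : ∀ k, Matchable (a k) (QuotientGroup.leftRel (U k)) (QuotientGroup.leftRel (V k))
      (Interleaved U V k)) :
    ∃ R : G → H → Prop, (∀ x, ∃ y, R x y) ∧ (∀ y, ∃ x, R x y) ∧
      ∀ k x y x' y', R x y → R x' y' → Interleaved U V k (x, y) (x', y') := by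
  have hstage : ∀ k, ∃ R : G → H → Prop, R 1 1 ∧ (∀ x ∈ U k, ∃ y, R x y) ∧
      (∀ y ∈ V k, ∃ x, R x y) ∧
      ∀ x y x' y', R x y → R x' y' → Interleaved U V k (x, y) (x', y') := by
    intro k
    have := hU k
    have : Infinite (Quotient (QuotientGroup.leftRel (U k))) := by
      by_contra hfin
      rw [not_infinite_iff_finite] at hfin
      have hfin' : Finite (G ⧸ U k) := hfin
      exact not_finite_iff_infinite.2 ‹Infinite G›
        (Finite.of_equiv _ (Subgroup.groupEquivQuotientProdSubgroup (s := U k)).symm)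
    obtain ⟨S, hS, hcard⟩ := Infinite.exists_superset_card_eq
      {Quotient.mk (QuotientGroup.leftRel (U k)) 1} (a k) (by simpa using ha k)
    obtain ⟨R, h₁, h₂, h₃, h₄⟩ :=
      hM k (Quotient.mk (QuotientGroup.leftRel (V k)) 1) S (Or.inl hcard)
    have h1S : Quotient.mk (QuotientGroup.leftRel (U k)) 1 ∈ S := hS (by simp)
    obtain ⟨y₀, hy₀⟩ := h₂ 1 h1S
    have hy₀V : y₀ ∈ V k := by
      simpa [QuotientGroup.leftRel_apply] using Quotient.exact (h₁ _ _ hy₀).2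
    -- `Interleaved` is invariant under left translation, so the matching can be normalised to
    -- relate 1 to 1.
    refine ⟨fun x y => R x (y₀ * y), by simpa using hy₀, fun x hx => ?_, fun y hy => ?_, ?_⟩
    · obtain ⟨y, hy⟩ := h₂ x (by
        rwa [Quotient.sound (s := QuotientGroup.leftRel (U k)) (a := x) (b := 1)
          (QuotientGroup.leftRel_apply.2 (by simpa using hx))])
      exact ⟨y₀⁻¹ * y, by simpa using hy⟩
    · exact h₃ _ (Quotient.sound (QuotientGroup.leftRel_apply.2
        (by simpa using (V k).inv_mem ((V k).mul_mem hy₀V hy))))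
    · intro x y x' y' h h'
      simpa [Interleaved, mul_assoc] using h₄ _ _ _ _ h h'
  choose R h1 hl hr hR using hstage
  let φ := hyperfilter ℕ
  have hge : ∀ i, ∀ᶠ k in (φ : Filter ℕ), i ≤ k := fun i =>
    Nat.hyperfilter_le_atTop (eventually_ge_atTop i)
  refine ⟨fun x y => ∀ᶠ k in (φ : Filter ℕ), R k x y, fun x => ?_, fun y => ?_, ?_⟩
  · obtain ⟨i, hi⟩ := hUtop x
    have := hV i
    -- Comparison with the pair (1, 1) confines the partners of `x` to a finite set independent of
    -- `k`, so the ultrafilter selects one.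
    have hev : ∀ᶠ k in (φ : Filter ℕ), ∃ y ∈ (V i : Set H), R k x y := by
      filter_upwards [hge i] with k hk
      obtain ⟨y, hy⟩ := hl k x (hUm hk hi)
      exact ⟨y, by simpa using (hR k _ _ _ _ (h1 k) hy).1 i hk (by simpa using hi), hy⟩
    obtain ⟨y, -, hy⟩ := (Ultrafilter.eventually_exists_mem_iff (Set.toFinite _)).1 hev
    exact ⟨y, hy⟩
  · obtain ⟨i, hi⟩ := hVtop y
    have := hU (i + 1)
    have hev : ∀ᶠ k in (φ : Filter ℕ), ∃ x ∈ (U (i + 1) : Set G), R k x y := by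
      filter_upwards [hge (i + 1)] with k hk
      obtain ⟨x, hx⟩ := hr k y (hVm (by omega) hi)
      exact ⟨x, by simpa using (hR k _ _ _ _ (h1 k) hx).2 i hk (by simpa using hi), hx⟩
    obtain ⟨x, -, hx⟩ := (Ultrafilter.eventually_exists_mem_iff (Set.toFinite _)).1 hev
    exact ⟨x, hx⟩
  · intro k x y x' y' h h'
    obtain ⟨n, ⟨hn, hn'⟩, hkn⟩ := ((h.and h').and (hge k)).exists
    obtain ⟨hl', hr'⟩ := hR n _ _ _ _ hn hn'
    exact ⟨fun i hi => hl' i (hi.trans hkn), fun i hi => hr' i (hi.trans_le hkn)⟩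

end Chains

/-! ### Finite balls and left-invariant metrics. -/

section Metric

theorem IsProper.infinite {X : Type*} [MetricSpace X] (h : IsProper X) : Infinite X := by
  by_contra hfin
  rw [not_infinite_iff_finite] at hfin
  exact h.unbounded (Set.toFinite _).isBounded

variable {G : Type*} [Group G] [MetricSpace G]

/-- By Baire, a countable complete space has an isolated point; left translation makes every point
isolated, and compact discrete balls are finite. -/
theorem IsProper.finite_closedBall [Countable G] (h : IsProper G) (hinv : IsLeftInvariant G)
    (r : ℝ) : (Metric.closedBall (1 : G) r).Finite := by
  have : ProperSpace G := ⟨fun x r => by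
    rcases le_or_gt 0 r with hr | hr
    · exact h.isCompact_closedBall x r hr
    · rw [Metric.closedBall_eq_empty.2 hr]
      exact isCompact_empty⟩
  obtain ⟨x, y, hy⟩ := nonempty_interior_of_iUnion_of_closed (f := fun x : G => {x})
    (fun x => isClosed_singleton) (Set.iUnion_of_singleton G)
  obtain ⟨ε, hε, hball⟩ := Metric.isOpen_iff.1 isOpen_interior y hy
  have hsing : ∀ z, dist z y < ε → z = x := fun z hz =>
    Set.mem_singleton_iff.1 (interior_subset (hball hz))
  obtain rfl : y = x := hsing y (by simpa using hε)
  have : DiscreteTopology G := discreteTopology_iff_isOpen_singleton.2 fun g => by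
    refine Metric.isOpen_iff.2 fun g' hg' => ⟨ε, hε, fun z hz => ?_⟩
    rw [Set.mem_singleton_iff.1 hg'] at hz
    have := hsing (y * g⁻¹ * z) (by
      have h2 := hinv (y * g⁻¹) z g
      rw [inv_mul_cancel_right] at h2
      rw [h2]
      exact hz)
    rw [mul_assoc, mul_eq_left] at this
    exact (inv_mul_eq_one.1 this).symm
  exact (ProperSpace.isCompact_closedBall (1 : G) r).finite_of_discrete

theorem IsLeftInvariant.dist_eq (hinv : IsLeftInvariant G) (x y : G) :
    dist x y = dist (x⁻¹ * y) 1 := by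
  rw [dist_comm, ← hinv x⁻¹ y x, inv_mul_cancel]

theorem IsLeftInvariant.exists_edist_le (hinv : IsLeftInvariant G) (U : Subgroup G) [Finite U] :
    ∃ ε : ℝ≥0, ∀ x y : G, x⁻¹ * y ∈ U → edist x y ≤ ε := by
  obtain ⟨r, hr⟩ := (Set.toFinite (U : Set G)).isBounded.subset_closedBall 1
  refine ⟨r.toNNReal, fun x y h => ?_⟩
  rw [edist_dist, hinv.dist_eq]
  exact ENNReal.ofReal_le_ofReal (hr h)

theorem IsLeftInvariant.macroUniform {H : Type*} [Group H] [MetricSpace H]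
    (hG : IsLeftInvariant G) (hH : IsLeftInvariant H) {f : G → H}
    {U : ℕ → Subgroup G} {V : ℕ → Subgroup H} (hV : ∀ k, Finite (V k))
    (hball : ∀ δ : ℝ≥0, ∃ k, Metric.closedBall (1 : G) δ ⊆ U k)
    (hf : ∀ k x y, x⁻¹ * y ∈ U k → (f x)⁻¹ * f y ∈ V k) : MacroUniform f := by
  intro δ
  obtain ⟨k, hk⟩ := hball δ
  have := hV k
  obtain ⟨ε, hε⟩ := hH.exists_edist_le (V k)
  refine ⟨ε, iSup_le fun x => iSup_le fun y => iSup_le fun hxy => hε _ _ (hf k _ _ (hk ?_))⟩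
  rw [Metric.mem_closedBall, ← hG.dist_eq]
  exact hxy

end Metric

end Coarse

theorem corollaryc2 {G : Type*} {H : Type*}
    [Group G] [Countable G] [MetricSpace G]
    [Group H] [Countable H] [MetricSpace H]
    (hG : Coarse.IsLocallyFiniteGroup G) (hH : Coarse.IsLocallyFiniteGroup H)
    (hGinv : Coarse.IsLeftInvariant G) (hHinv : Coarse.IsLeftInvariant H)
    (hGprop : Coarse.IsProper G) (hHprop : Coarse.IsProper H) :
    Coarse.CoarselyEquivalent G H := by
  have := hGprop.infinite
  have := hHprop.infinite
  obtain ⟨U, V, a, hU, hV, hUm, hVm, hF, hE, ha, hUV⟩ := Coarse.exists_chains hG hH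
    (fun k : ℕ => hGprop.finite_closedBall hGinv k) (fun k : ℕ => hHprop.finite_closedBall hHinv k)
  have hballG : ∀ r : ℝ, ∃ k, Metric.closedBall (1 : G) r ⊆ U k := fun r =>
    (exists_nat_ge r).imp' (· + 1) fun n hn => (Metric.closedBall_subset_closedBall hn).trans (hF n)
  have hballH : ∀ r : ℝ, ∃ k, Metric.closedBall (1 : H) r ⊆ V k := fun r =>
    (exists_nat_ge r).imp' (· + 1) fun n hn => (Metric.closedBall_subset_closedBall hn).trans (hE n)
  obtain ⟨R, hl, hr, hR⟩ := Coarse.exists_interleaved_relation hU hV hUm hVm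
    (fun x => (hballG (dist x 1)).imp fun k hk => hk (Metric.mem_closedBall.2 le_rfl))
    (fun y => (hballH (dist y 1)).imp fun k hk => hk (Metric.mem_closedBall.2 le_rfl)) ha
    (Coarse.matchable_interleaved hU hV hUm hVm ha hUV)
  choose f hf using hl
  choose g hg using hr
  have hU1 := hU 1
  have hV0 := hV 0
  obtain ⟨ε, hε⟩ := hGinv.exists_edist_le (U 1)
  obtain ⟨ε', hε'⟩ := hHinv.exists_edist_le (V 0)
  refine ⟨f, hGinv.macroUniform hHinv hV (fun δ => hballG δ)
    (fun k x y => (hR k _ _ _ _ (hf x) (hf y)).1 k le_rfl), g,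
    hHinv.macroUniform hGinv (fun k => hU (k + 1)) (fun δ => hballH δ)
    (fun k x y => (hR (k + 1) _ _ _ _ (hg x) (hg y)).2 k k.lt_succ_self), ?_, ?_⟩
  · refine lt_of_le_of_lt (iSup_le fun y => hε' _ _ ?_) ENNReal.coe_lt_top
    -- Both `f (g y)` and `y` are related to `g y`, so they lie in one coset of `V 0`.
    exact (hR 0 _ _ _ _ (hf (g y)) (hg y)).1 0 le_rfl (by simp)
  · refine lt_of_le_of_lt (iSup_le fun x => hε _ _ ?_) ENNReal.coe_lt_top
    exact (hR 1 _ _ _ _ (hg (f x)) (hf x)).2 0 one_pos (by simp)
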